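/- Let $\mathcal I$ be a countable commutative semiring (a unit is not required) whose addition is cancellative, and let $p\colon(\mathcal I,+)\to\mathbb Z/2$ be a non-trivial monoid homomorphism. For a finite-dimensional real vector space $V=\bigoplus_{i\in\mathcal I}V_i$ with $V_0=0$, let $S(V)$ be the quotient of the tensor algebra $T(V)$ by the two-sided ideal generated by all $v\otimes w-(-1)^{p(ij)}\,w\otimes v$ with $v\in V_i$, $w\in V_j$. Let $S^n(V)\subseteq S(V)$ be the span of the products of $n$ vectors, and $S^n(V)_i\subseteq S^n(V)$ the span of the products $v_1\cdots v_n$ of homogeneous vectors whose degrees add up to $i$. Let $\overline{S(V)}=\prod_{n\ge 0}S^n(V)$ be the algebra of formal power series on $V$, with the Cauchy product; an element of it is homogeneous of degree $i$ if its component in $S^n(V)$ lies in $S^n(V)_i$ for every $n$. An $\mathcal I$-graded domain is a ringed space $\mathcal U=(U,\mathcal O)$, where $U\subseteq\mathbb R^m$ is open ($m\ge 0$) and, for some $V$ as above, $\mathcal O$ is the sheaf of smooth $\overline{S(V)}$-valued functions, i.e. of functions all of whose components in the finite-dimensional spaces $S^n(V)$ are smooth. A section $f\in\mathcal O(W)$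 is homogeneous of degree $i$, written $f\in\mathcal O(W)_i$, if all its values are. A ring homomorphism between rings of sections preserves the $\mathcal I$-grading if it maps homogeneous sections of degree $i$ to homogeneous sections of degree $i$, for every $i\in\mathcal I$. A morphism of $\mathcal I$-graded domains $\varphi=(\tilde\varphi,\varphi^*)\colon(U_1,\mathcal O_1)\to(U_2,\mathcal O_2)$ is a morphism of locally ringed spaces (a morphism of ringed spaces that induces local homomorphisms on the stalks) such that $\varphi^*_W\colon\mathcal O_2(W)\to\mathcal O_1(\tilde\varphi^{-1}(W))$ preserves the $\mathcal I$-grading for every open $W\subseteq U_2$. Theorem. Let $\mathcal U_1=(U_1,\mathcal O_1)$ and $\mathcal U_2=(U_2,\mathcal O_2)$ be $\mathcal I$-graded domains (of possibly different dimensions), and let $\varphi^*\colon\mathcal O_2(U_2)\to\mathcal O_1(U_1)$ be a unital ring homomorphism that preserves the $\mathcal I$-grading. Then there exists a unique morphism of $\mathcal I$-graded domains $\varphi'\colon\mathcal U_1\to\mathcal U_2$ such that $\varphi'^*_{U_2}=\varphi^*$. -/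

import Mathlib

open CategoryTheory Opposite TopologicalSpace
open scoped Manifold ContDiff

noncomputable section

namespace GradedGeometry

/-! ## The symmetric algebra and the formal power series on a graded vector space -/

section Algebra

variable {I : Type*} [NonUnitalCommSemiring I] (p : I →+ ZMod 2)
  {V : Type} [AddCommGroup V] [Module ℝ V] (𝒱 : I → Submodule ℝ V)

/-- The relations `v ⊗ w = (-1)^{p(ij)} w ⊗ v`, for `v` of degree `i` and `w` of degree `j`. -/
inductive SymRel : TensorAlgebra ℝ V → TensorAlgebra ℝ V → Prop
  | swap {i j : I} {v w : V} (hv : v ∈ 𝒱 i) (hw : w ∈ 𝒱 j) :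
      SymRel (TensorAlgebra.ι ℝ v * TensorAlgebra.ι ℝ w)
        ((-1 : ℝ) ^ (p (i * j)).val • (TensorAlgebra.ι ℝ w * TensorAlgebra.ι ℝ v))

/-- The graded symmetric algebra `S(V)`: the quotient of the tensor algebra `T(V)` by the two-sided
ideal generated by the elements `v ⊗ w - (-1)^{p(ij)} w ⊗ v`. -/
def SymAlg : Type := (ringConGen (SymRel p 𝒱)).Quotient

instance : Ring (SymAlg p 𝒱) := inferInstanceAs <| Ring (RingCon.Quotient _)

instance : Algebra ℝ (SymAlg p 𝒱) := inferInstanceAs <| Algebra ℝ (RingCon.Quotient _)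

/-- The quotient map `T(V) → S(V)`. -/
def SymAlg.mk : TensorAlgebra ℝ V →ₐ[ℝ] SymAlg p 𝒱 := RingCon.mkₐ ℝ (ringConGen (SymRel p 𝒱))

/-- The canonical map `V → S(V)`. -/
def SymAlg.ι : V →ₗ[ℝ] SymAlg p 𝒱 :=
  (SymAlg.mk p 𝒱).toLinearMap ∘ₗ TensorAlgebra.ι ℝ

/-- `Sⁿ(V)`, the linear span of the products of `n` vectors. -/
def symPower (n : ℕ) : Submodule ℝ (SymAlg p 𝒱) :=
  LinearMap.range (SymAlg.ι p 𝒱) ^ n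

/-- `Sⁿ(V)ᵢ`, the part of `Sⁿ(V)` of degree `i`: the linear span of the products `v₁ ⋯ vₙ` of
homogeneous vectors whose degrees add up to `i`. -/
def symComponent (n : ℕ) (i : I) : Submodule ℝ (SymAlg p 𝒱) :=
  Submodule.span ℝ {x | ∃ (v : Fin n → V) (d : Fin n → I),
    (∀ k, v k ∈ 𝒱 (d k)) ∧ ∑ k, d k = i ∧ x = (List.ofFn fun k => SymAlg.ι p 𝒱 (v k)).prod}

/-- The algebra of formal power series on `V`, that is `∏ₙ Sⁿ(V)` with the Cauchy product. A family
`(fₙ)` with `fₙ ∈ Sⁿ(V)` is written as the series `∑ₙ fₙ Xⁿ` with coefficients in `S(V)`. -/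
def formalSym : Subring (PowerSeries (SymAlg p 𝒱)) where
  carrier := {f | ∀ n, PowerSeries.coeff n f ∈ symPower p 𝒱 n}
  mul_mem' {f g} hf hg n := by
    rw [PowerSeries.coeff_mul]
    refine Submodule.sum_mem _ fun ab hab => ?_
    rw [← Finset.HasAntidiagonal.mem_antidiagonal.1 hab, symPower, pow_add]
    exact Submodule.mul_mem_mul (hf _) (hg _)
  one_mem' n := by
    rw [PowerSeries.coeff_one]
    split_ifs with h
    · subst h
      simp [symPower, Submodule.one_le.1 le_rfl]
    · exact Submodule.zero_mem _
  add_mem' {f g} hf hg n := by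
    rw [map_add]
    exact Submodule.add_mem _ (hf n) (hg n)
  zero_mem' n := by
    rw [map_zero]
    exact Submodule.zero_mem _
  neg_mem' {f} hf n := by
    rw [map_neg]
    exact Submodule.neg_mem _ (hf n)

variable {p 𝒱}

/-- The component in `Sⁿ(V)` of a formal power series. -/
def component (n : ℕ) (f : formalSym p 𝒱) : SymAlg p 𝒱 := PowerSeries.coeff n f.1

/-- A formal power series is homogeneous of degree `i` if each of its components is. -/
def IsHomogeneousSeries (i : I) (f : formalSym p 𝒱) : Prop :=
  ∀ n, component n f ∈ symComponent p 𝒱 n i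

end Algebra

/-! ## Smooth functions with values in the formal power series -/

section Smooth

variable {I : Type*} [NonUnitalCommSemiring I] (p : I →+ ZMod 2)
  {V : Type} [AddCommGroup V] [Module ℝ V] (𝒱 : I → Submodule ℝ V)
  {m : ℕ} (U : Opens (EuclideanSpace ℝ (Fin m)))

/-- Smoothness of a function with values in `∏ₙ Sⁿ(V)`: each of its components, a function with
values in the finite dimensional vector space `Sⁿ(V)`, has smooth coordinates. -/
def IsSmooth {W : Opens U} (f : W → formalSym p 𝒱) : Prop :=
  ∀ (n : ℕ) (l : Module.Dual ℝ (SymAlg p 𝒱)),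
    ContMDiff 𝓘(ℝ, EuclideanSpace ℝ (Fin m)) 𝓘(ℝ, ℝ) ∞ fun x => l (component n (f x))

variable {p 𝒱 U} in
/-- The product of smooth functions is smooth, because each `Sⁿ(V)` is finite dimensional. -/
theorem IsSmooth.mul [FiniteDimensional ℝ V] {W : Opens U} {f g : W → formalSym p 𝒱}
    (hf : IsSmooth p 𝒱 U f) (hg : IsSmooth p 𝒱 U g) : IsSmooth p 𝒱 U (f * g) := by
  intro n l
  have key : ∀ a b : ℕ, ContMDiff 𝓘(ℝ, EuclideanSpace ℝ (Fin m)) 𝓘(ℝ, ℝ) ∞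
      fun x => l (component a (f x) * component b (g x)) := by
    intro a b
    have hfin : FiniteDimensional ℝ (symPower p 𝒱 a) := by
      rw [FiniteDimensional, Module.Finite.iff_fg]
      exact Submodule.FG.pow (Module.Finite.iff_fg.1 inferInstance) a
    let B := Module.finBasis ℝ (symPower p 𝒱 a)
    obtain ⟨P, hP⟩ := (symPower p 𝒱 a).exists_isCompl
    let π : SymAlg p 𝒱 →ₗ[ℝ] symPower p 𝒱 a := Submodule.projectionOnto _ _ hP
    have hπ : ∀ x, component a (f x) = ∑ k, B.coord k (π (component a (f x))) • (B k : SymAlg p 𝒱) := by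
      intro x
      have h1 : π (component a (f x)) = ⟨component a (f x), (f x).2 a⟩ :=
        Submodule.projectionOnto_apply_left hP ⟨component a (f x), (f x).2 a⟩
      have h2 := congrArg (symPower p 𝒱 a).subtype (B.sum_repr ⟨component a (f x), (f x).2 a⟩)
      rw [map_sum] at h2
      rw [h1]
      exact h2.symm
    have h3 : (fun x => l (component a (f x) * component b (g x))) = fun x =>
        ∑ k, ((B.coord k ∘ₗ π) (component a (f x))) *
          ((l ∘ₗ LinearMap.mulLeft ℝ (B k : SymAlg p 𝒱)) (component b (g x))) := by
      funext x
      conv_lhs => rw [hπ x]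
      simp [Finset.sum_mul, map_sum]
    rw [h3]
    exact contMDiff_finsetSum fun k _ => (hf a _).mul (hg b _)
  have h4 : (fun x => l (component n ((f * g) x))) = fun x =>
      ∑ ab ∈ Finset.HasAntidiagonal.antidiagonal n, l (component ab.1 (f x) * component ab.2 (g x)) := by
    funext x
    simp [component, PowerSeries.coeff_mul, map_sum]
  rw [h4]
  exact contMDiff_finsetSum fun ab _ => key _ _

/-- The ring of smooth functions on `W` with values in the formal power series on `V`. -/
def smoothSections [FiniteDimensional ℝ V] (W : Opens U) : Subring (W → formalSym p 𝒱) where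
  carrier := {f | IsSmooth p 𝒱 U f}
  mul_mem' {f g} hf hg := IsSmooth.mul (f := f) (g := g) hf hg
  one_mem' n l := contMDiff_const (c := l (component n (1 : formalSym p 𝒱)))
  zero_mem' n l := contMDiff_const (c := l (component n (0 : formalSym p 𝒱)))
  add_mem' {f g} hf hg n l := by
    have h : (fun x => l (component n ((f + g) x))) =
        (fun x => l (component n (f x))) + fun x => l (component n (g x)) := by
      funext x
      simp [component]
    rw [h]
    exact (hf n l).add (hg n l)
  neg_mem' {f} hf n l := by
    simpa [component] using (hf n l).neg

variable {p 𝒱 U} in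
theorem isSmooth_val [FiniteDimensional ℝ V] {W : Opens U} (f : smoothSections p 𝒱 U W) :
    IsSmooth p 𝒱 U f.1 := f.2

variable {U} in
/-- Restriction of smooth functions to a smaller open set. -/
def smoothSections.restrict [FiniteDimensional ℝ V] {W₁ W₂ : Opens U} (h : W₁ ≤ W₂) :
    smoothSections p 𝒱 U W₂ →+* smoothSections p 𝒱 U W₁ where
  toFun f := ⟨fun x => f.1 ⟨x.1, h x.2⟩, fun n l =>
    (isSmooth_val f n l).comp (contMDiff_inclusion h)⟩
  map_one' := rfl
  map_mul' _ _ := rfl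
  map_zero' := rfl
  map_add' _ _ := rfl

/-- Smoothness is a local condition. -/
def smoothPredicate : TopCat.LocalPredicate fun _ : TopCat.of U => formalSym p 𝒱 where
  pred {W} f := IsSmooth p 𝒱 U (W := W) f
  res {_ _} i _ hf n l := (hf n l).comp (contMDiff_inclusion (leOfHom i))
  locality {W} f hf n l := by
    classical
    intro x
    obtain ⟨W', hx, i, h⟩ := hf x
    have h' := h n l ⟨x.1, hx⟩
    have h5 := (contMDiffAt_subtype_iff (U := W') (f := fun y : U =>
      if hy : y ∈ W then l (component n (f ⟨y, hy⟩)) else 0) (x := ⟨x.1, hx⟩)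
      (I := 𝓘(ℝ, EuclideanSpace ℝ (Fin m))) (I' := 𝓘(ℝ, ℝ)) (n := ∞)).1 (by
        convert h' using 2 with y
        exact dif_pos (leOfHom i y.2))
    have h6 := (contMDiffAt_subtype_iff (U := (W : Opens U)) (x := x)).2 h5
    refine h6.congr_of_eventuallyEq (Filter.Eventually.of_forall fun y => ?_)
    exact (dif_pos (c := y.1 ∈ W) (t := fun hy => l (component n (f ⟨y.1, hy⟩)))
      (e := fun _ => (0 : ℝ)) y.2).symm

/-- The presheaf of rings of smooth functions with values in the formal power series on `V`. -/
def structurePresheaf [FiniteDimensional ℝ V] : TopCat.Presheaf RingCat.{0} (TopCat.of U) where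
  obj W := RingCat.of (smoothSections p 𝒱 U W.unop)
  map h := RingCat.ofHom (smoothSections.restrict p 𝒱 (leOfHom h.unop))
  map_id _ := rfl
  map_comp _ _ := rfl

theorem structurePresheaf_isSheaf [FiniteDimensional ℝ V] :
    (structurePresheaf p 𝒱 U).IsSheaf := by
  rw [TopCat.Presheaf.IsSheaf,
    CategoryTheory.Presheaf.isSheaf_iff_isSheaf_forget _ _ (CategoryTheory.forget RingCat)]
  exact (TopCat.subsheafToTypes (smoothPredicate p 𝒱 U)).property

end Smooth

/-! ## Graded domains and their morphisms -/

open scoped Classical in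
/-- The data of an `I`-graded domain: an open subset `U` of `ℝⁿ`, and a finite dimensional real
`I`-graded vector space `V = ⨁ᵢ Vᵢ` with `V₀ = 0`. -/
structure GradedDomain (I : Type*) [NonUnitalCommSemiring I] where
  dim : ℕ
  U : Opens (EuclideanSpace ℝ (Fin dim))
  V : Type
  [addCommGroup : AddCommGroup V]
  [module : Module ℝ V]
  [finiteDimensional : FiniteDimensional ℝ V]
  grade : I → Submodule ℝ V
  isInternal : DirectSum.IsInternal grade
  grade_zero : grade 0 = ⊥

attribute [instance] GradedDomain.addCommGroup GradedDomain.module GradedDomain.finiteDimensional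

namespace GradedDomain

variable {I : Type*} [NonUnitalCommSemiring I] (p : I →+ ZMod 2)

/-- The ringed space `(U, 𝒪)`, where `𝒪` is the sheaf of smooth functions with values in the
formal power series on `V`. -/
def toRingedSpace (𝒰 : GradedDomain I) : AlgebraicGeometry.SheafedSpace RingCat.{0} where
  carrier := TopCat.of 𝒰.U
  presheaf := structurePresheaf p 𝒰.grade 𝒰.U
  IsSheaf := structurePresheaf_isSheaf p 𝒰.grade 𝒰.U

/-- The ring `𝒪(W)`. -/
abbrev Sections (𝒰 : GradedDomain I) (W : Opens 𝒰.U) : Type :=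
  smoothSections p 𝒰.grade 𝒰.U W

variable {p} in
/-- `f ∈ 𝒪(W)ᵢ`: all values of `f` are homogeneous of degree `i`. -/
def IsHomogeneous {𝒰 : GradedDomain I} {W : Opens 𝒰.U} (i : I) (f : 𝒰.Sections p W) : Prop :=
  ∀ x, IsHomogeneousSeries i (f.1 x)

variable {p} in
/-- A ring homomorphism between rings of sections preserves the grading if it maps homogeneous
elements of degree `i` to homogeneous elements of degree `i`, for all `i`. -/
def PreservesGrading {𝒰₁ 𝒰₂ : GradedDomain I} {W₁ : Opens 𝒰₁.U} {W₂ : Opens 𝒰₂.U}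
    (φ : 𝒰₂.Sections p W₂ →+* 𝒰₁.Sections p W₁) : Prop :=
  ∀ (i : I) (f : 𝒰₂.Sections p W₂), IsHomogeneous i f → IsHomogeneous i (φ f)

variable {p} in
/-- The ring homomorphism `φ*_W : 𝒪₂(W) → 𝒪₁(φ⁻¹(W))` that belongs to a morphism of ringed
spaces. -/
def pullback {𝒰₁ 𝒰₂ : GradedDomain I} (φ : 𝒰₁.toRingedSpace p ⟶ 𝒰₂.toRingedSpace p)
    (W : Opens 𝒰₂.U) : 𝒰₂.Sections p W →+* 𝒰₁.Sections p ((Opens.map φ.hom.base).obj W) :=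
  (φ.hom.c.app (op W)).hom

/-- A morphism of `I`-graded domains: a morphism of locally ringed spaces (a morphism of ringed
spaces which is local on the stalks) such that all `φ*_W` preserve the grading. -/
@[ext]
structure Hom (𝒰₁ 𝒰₂ : GradedDomain I) where
  toRingedSpaceHom : 𝒰₁.toRingedSpace p ⟶ 𝒰₂.toRingedSpace p
  isLocalHom_stalkMap : ∀ x : 𝒰₁.toRingedSpace p,
    IsLocalHom (toRingedSpaceHom.hom.stalkMap x).hom
  preservesGrading : ∀ W : Opens 𝒰₂.U, PreservesGrading (pullback toRingedSpaceHom W)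

variable {p} in
/-- The map `φ* : 𝒪₂(U₂) → 𝒪₁(U₁)` on global sections. -/
def Hom.globalPullback {𝒰₁ 𝒰₂ : GradedDomain I} (φ : Hom p 𝒰₁ 𝒰₂) :
    𝒰₂.Sections p ⊤ →+* 𝒰₁.Sections p ⊤ :=
  pullback φ.toRingedSpaceHom ⊤

end GradedDomain

end GradedGeometry

end

/-! A formal power series with nonzero constant term (its body) is invertible, by the geometric
series. The body of a section is an ordinary smooth function, and it decides invertibility of
sections (`isUnit_of_body_ne_zero`) and of germs (`isUnit_germ_iff`).

Hence a Milnor-type theorem: every ring homomorphism from global sections to ℝ evaluates the body at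
a point (`exists_eq_bodyAt`), which is unique because coordinates separate points. Linearity over ℝ
is automatic, as ℝ has no ring endomorphism but the identity. Composing `φ` with the evaluations on
`U₁` yields the base map `basePoint`.

Bump functions make `φ` local: near `x`, `φ g` depends only on `g` near the base point of `x`
(`map_agreeNear`). So a section over a smaller open set can be mapped pointwise by applying `φ` to
any global extension (`localMap`). This commutes with bodies, hence is local on stalks. Conversely,
locality on stalks forces bodies to commute (`Hom.bodyAt_pullback`), so the global pullback
determines the base map, and cutoff extensions determine all other pullbacks. -/

noncomputable section

namespace GradedGeometry

/-! ### Constant terms of formal power series -/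

section Body

variable {I : Type*} [NonUnitalCommSemiring I] (p : I →+ ZMod 2)
  {V : Type} [AddCommGroup V] [Module ℝ V] (𝒱 : I → Submodule ℝ V)

/-- The augmentation `S(V) → ℝ`, which kills all vectors. -/
def SymAlg.augmentation : SymAlg p 𝒱 →ₐ[ℝ] ℝ where
  __ := RingCon.lift (ringConGen (SymRel p 𝒱))
    (TensorAlgebra.lift ℝ (0 : V →ₗ[ℝ] ℝ)).toRingHom (by
      refine RingCon.ringConGen_le.2 fun x y h => ?_
      obtain ⟨hv, hw⟩ := h
      simp [RingCon.ker_apply])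
  commutes' r := (TensorAlgebra.lift ℝ (0 : V →ₗ[ℝ] ℝ)).commutes r

/-- The real numbers, as constant formal power series. -/
def scalar : ℝ →+* formalSym p 𝒱 :=
  ((PowerSeries.C (R := SymAlg p 𝒱)).comp (algebraMap ℝ (SymAlg p 𝒱))).codRestrict _ fun r n => by
    rw [RingHom.comp_apply, PowerSeries.coeff_C]
    split_ifs with h
    · subst h
      simp [symPower, Submodule.mem_one]
    · exact Submodule.zero_mem _

/-- The constant term of a formal power series. -/
def body : formalSym p 𝒱 →+* ℝ :=
  (SymAlg.augmentation p 𝒱).toRingHom.comp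
    ((PowerSeries.constantCoeff (R := SymAlg p 𝒱)).comp (formalSym p 𝒱).subtype)

variable {p 𝒱}

theorem body_eq_component (f : formalSym p 𝒱) :
    body p 𝒱 f = SymAlg.augmentation p 𝒱 (component 0 f) := by
  simp [body, component]

theorem component_zero_eq (f : formalSym p 𝒱) :
    component 0 f = algebraMap ℝ (SymAlg p 𝒱) (body p 𝒱 f) := by
  have h : component 0 f ∈ symPower p 𝒱 0 := f.2 0
  rw [symPower, pow_zero, Submodule.mem_one] at h
  obtain ⟨r, hr⟩ := h
  rw [body_eq_component, ← hr, AlgHom.commutes, Algebra.algebraMap_self_apply]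

theorem coe_scalar (r : ℝ) :
    (scalar p 𝒱 r : PowerSeries (SymAlg p 𝒱)) = PowerSeries.C (algebraMap ℝ (SymAlg p 𝒱) r) :=
  rfl

@[simp]
theorem body_scalar (r : ℝ) : body p 𝒱 (scalar p 𝒱 r) = r := by
  simp [body, coe_scalar]

theorem component_scalar (r : ℝ) (n : ℕ) :
    component n (scalar p 𝒱 r) = if n = 0 then algebraMap ℝ (SymAlg p 𝒱) r else 0 := by
  simp [component, coe_scalar, PowerSeries.coeff_C]

theorem component_scalar_mul (r : ℝ) (f : formalSym p 𝒱) (n : ℕ) :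
    component n (scalar p 𝒱 r * f) = r • component n f := by
  simp [component, coe_scalar, Algebra.smul_def]

/-- Since `S⁰(V)` consists of scalars, a vanishing body means a vanishing constant coefficient, so
`f ^ k` has order at least `k`. This makes the geometric series converge. -/
theorem component_mul_of_body_pow {f : formalSym p 𝒱} (hf : body p 𝒱 f = 0) (g : formalSym p 𝒱)
    {n k : ℕ} (h : n < k) : component n (f ^ k * g) = 0 := by
  have h0 : PowerSeries.constantCoeff f.1 = 0 := by
    have := component_zero_eq f
    rwa [hf, map_zero, component, PowerSeries.coeff_zero_eq_constantCoeff_apply] at this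
  have h1 := PowerSeries.le_order_pow_of_constantCoeff_eq_zero k h0
  refine PowerSeries.coeff_of_lt_order n ?_
  have h2 := PowerSeries.le_order_mul (f.1 ^ k) g.1
  refine lt_of_lt_of_le (by exact_mod_cast h) ((h1.trans le_self_add).trans h2)

@[ext]
theorem formalSym_ext {f g : formalSym p 𝒱} (h : ∀ n, component n f = component n g) : f = g :=
  Subtype.ext (PowerSeries.ext h)

end Body

/-! ### Invertible sections -/

section Units

variable {I : Type*} [NonUnitalCommSemiring I] {p : I →+ ZMod 2}
  {V : Type} [AddCommGroup V] [Module ℝ V] {𝒱 : I → Submodule ℝ V}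
  {m : ℕ} {U : Opens (EuclideanSpace ℝ (Fin m))} [FiniteDimensional ℝ V]

/-- A smooth real function as a section. -/
def ofSmooth {W : Opens U} (a : W → ℝ)
    (ha : ContMDiff 𝓘(ℝ, EuclideanSpace ℝ (Fin m)) 𝓘(ℝ, ℝ) ∞ a) : smoothSections p 𝒱 U W :=
  ⟨fun x => scalar p 𝒱 (a x), fun n l => by
    simp only [component_scalar]
    split_ifs with h
    · have : (fun x => l (algebraMap ℝ (SymAlg p 𝒱) (a x))) = fun x => a x * l 1 := by
        funext x
        rw [Algebra.algebraMap_eq_smul_one, map_smul, smul_eq_mul]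
      rw [this]
      exact ha.mul contMDiff_const
    · simpa using contMDiff_const⟩

theorem contMDiff_body {W : Opens U} (f : smoothSections p 𝒱 U W) :
    ContMDiff 𝓘(ℝ, EuclideanSpace ℝ (Fin m)) 𝓘(ℝ, ℝ) ∞ fun x => body p 𝒱 (f.1 x) := by
  simp only [body_eq_component]
  exact f.2 0 (SymAlg.augmentation p 𝒱).toLinearMap

theorem exists_mul_eq_one_of_body_eq_zero {W : Opens U} (f : smoothSections p 𝒱 U W)
    (hf : ∀ x, body p 𝒱 (f.1 x) = 0) : ∃ g : smoothSections p 𝒱 U W, (1 - f) * g = 1 := by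
  let P : ℕ → smoothSections p 𝒱 U W := fun n => ∑ k ∈ Finset.range (n + 1), f ^ k
  have hP : ∀ n x, (P n).1 x = ∑ k ∈ Finset.range (n + 1), f.1 x ^ k := by
    intro n x
    simp [P, AddSubmonoidClass.coe_finsetSum]
  have hc : ∀ n k x, n ≤ k → component n ((P k).1 x) = component n ((P n).1 x) := by
    intro n k x h
    induction k, h using Nat.le_induction with
    | base => rfl
    | succ k h ih =>
      rw [← ih, hP, hP, Finset.sum_range_succ]
      have := component_mul_of_body_pow (hf x) 1 (Nat.lt_succ_of_le h)
      rw [mul_one] at this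
      simp only [component] at this ⊢
      rw [Subring.coe_add, map_add, this, add_zero]
  let G : W → formalSym p 𝒱 := fun x =>
    -- The geometric series: its `n`-th component is already that of the `n`-th partial sum.
    ⟨PowerSeries.mk fun n => component n ((P n).1 x), fun n => by
      rw [PowerSeries.coeff_mk]
      exact ((P n).1 x).2 n⟩
  have hG : ∀ n x, component n (G x) = component n ((P n).1 x) := fun n x =>
    PowerSeries.coeff_mk n fun n => component n ((P n).1 x)
  refine ⟨⟨G, fun n l => ?_⟩, ?_⟩
  · simp only [hG]
    exact (P n).2 n l
  · refine Subtype.ext (funext fun x => formalSym_ext fun n => ?_)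
    -- Up to order `n` the series may be replaced by its `n`-th partial sum, for which the product
    -- telescopes.
    have h1 : component n ((1 - f.1 x) * G x) = component n ((1 - f.1 x) * (P n).1 x) := by
      simp only [component, Subring.coe_mul, PowerSeries.coeff_mul]
      refine Finset.sum_congr rfl fun ab hab => ?_
      have hle : ab.2 ≤ n := by
        have := Finset.HasAntidiagonal.mem_antidiagonal.1 hab
        omega
      congr 1
      exact (hG ab.2 x).trans (hc ab.2 n x hle).symm
    refine h1.trans ?_
    rw [hP, mul_neg_geom_sum]
    have := component_mul_of_body_pow (hf x) 1 (Nat.lt_succ_self n)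
    rw [mul_one] at this
    simp only [component] at this ⊢
    rw [AddSubgroupClass.coe_sub, map_sub, this, sub_zero]
    rfl

/-- Dividing by the body reduces to body 1, that is, to 1 minus a section of body 0. -/
theorem exists_mul_eq_one {W : Opens U} (f : smoothSections p 𝒱 U W)
    (hf : ∀ x, body p 𝒱 (f.1 x) ≠ 0) : ∃ g : smoothSections p 𝒱 U W, f * g = 1 := by
  let a : smoothSections p 𝒱 U W :=
    ofSmooth (fun x => (body p 𝒱 (f.1 x))⁻¹) fun x => (contMDiff_body f x).inv₀ (hf x)
  obtain ⟨g, hg⟩ := exists_mul_eq_one_of_body_eq_zero (1 - f * a) fun x => by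
    change body p 𝒱 (1 - f.1 x * scalar p 𝒱 _) = 0
    simp [hf x]
  exact ⟨a * g, by rwa [sub_sub_cancel, mul_assoc] at hg⟩

/-- A section is invertible if its constant term vanishes nowhere. -/
theorem isUnit_of_body_ne_zero {W : Opens U} (f : smoothSections p 𝒱 U W)
    (hf : ∀ x, body p 𝒱 (f.1 x) ≠ 0) : IsUnit f := by
  obtain ⟨g, hg⟩ := exists_mul_eq_one f hf
  -- The ring need not be commutative, so the right inverse is given a right inverse of its own,
  -- which must be `f`.
  obtain ⟨h, hh⟩ := exists_mul_eq_one g fun x h0 => by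
    have : body p 𝒱 (f.1 x * g.1 x) = 1 := by
      have h1 : f.1 x * g.1 x = 1 := congrFun (congrArg Subtype.val hg) x
      rw [h1, map_one]
    rw [map_mul, h0, mul_zero] at this
    exact zero_ne_one this
  have : f = h := left_inv_eq_right_inv hg hh ▸ rfl
  exact ⟨⟨f, g, hg, this ▸ hh⟩, rfl⟩

end Units

/-! ### Real-valued characters are points -/

section Points

variable {I : Type*} [NonUnitalCommSemiring I] {p : I →+ ZMod 2}
  {V : Type} [AddCommGroup V] [Module ℝ V] {𝒱 : I → Submodule ℝ V}
  {m : ℕ} {U : Opens (EuclideanSpace ℝ (Fin m))} [FiniteDimensional ℝ V]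

theorem contMDiff_comp_coe (W : Opens U) {h : EuclideanSpace ℝ (Fin m) → ℝ} (hh : ContDiff ℝ ∞ h) :
    ContMDiff 𝓘(ℝ, EuclideanSpace ℝ (Fin m)) 𝓘(ℝ, ℝ) ∞ fun x : W => h x.1.1 :=
  hh.contMDiff.comp (contMDiff_subtype_val.comp contMDiff_subtype_val)

@[simp]
theorem body_ofSmooth {W : Opens U} (a : W → ℝ)
    (ha : ContMDiff 𝓘(ℝ, EuclideanSpace ℝ (Fin m)) 𝓘(ℝ, ℝ) ∞ a) (x : W) :
    body p 𝒱 ((ofSmooth (p := p) (𝒱 := 𝒱) a ha).1 x) = a x :=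
  body_scalar _

/-- The value of the constant term of a section at a point. -/
def bodyAt {W : Opens U} (x : W) : smoothSections p 𝒱 U W →+* ℝ :=
  (body p 𝒱).comp ((Pi.evalRingHom _ x).comp (smoothSections p 𝒱 U W).subtype)

theorem bodyAt_apply {W : Opens U} (x : W) (f : smoothSections p 𝒱 U W) :
    bodyAt x f = body p 𝒱 (f.1 x) := rfl

/-- Real numbers as constant sections. -/
def constSection (W : Opens U) : ℝ →+* smoothSections p 𝒱 U W where
  toFun r := ofSmooth (fun _ => r) contMDiff_const
  map_one' := Subtype.ext (funext fun _ => map_one (scalar p 𝒱))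
  map_zero' := Subtype.ext (funext fun _ => map_zero (scalar p 𝒱))
  map_add' r s := Subtype.ext (funext fun _ => map_add (scalar p 𝒱) r s)
  map_mul' r s := Subtype.ext (funext fun _ => map_mul (scalar p 𝒱) r s)

@[simp]
theorem bodyAt_constSection {W : Opens U} (x : W) (r : ℝ) :
    bodyAt (p := p) (𝒱 := 𝒱) x (constSection W r) = r :=
  body_scalar (p := p) (𝒱 := 𝒱) r

theorem map_constSection {W : Opens U} (χ : smoothSections p 𝒱 U W →+* ℝ) (r : ℝ) :
    χ (constSection W r) = r :=
  congrArg (fun h : ℝ →+* ℝ => h r) (Subsingleton.elim (χ.comp (constSection W)) (RingHom.id ℝ))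

/-- Otherwise the sum of the squares of `f - χ f` has a nowhere vanishing body and is a unit, yet
`χ` kills it. -/
theorem exists_bodyAt_eq_of_finset {W : Opens U} (χ : smoothSections p 𝒱 U W →+* ℝ)
    (u : Finset (smoothSections p 𝒱 U W)) : ∃ x : W, ∀ f ∈ u, bodyAt x f = χ f := by
  by_contra! h
  have h1 : IsUnit (∑ f ∈ u, (f - constSection W (χ f)) ^ 2) := by
    refine isUnit_of_body_ne_zero _ fun x h0 => ?_
    rw [← bodyAt_apply, map_sum] at h0
    simp only [map_pow, map_sub, bodyAt_constSection] at h0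
    obtain ⟨f, hf, hne⟩ := h x
    exact hne (sub_eq_zero.1 (pow_eq_zero_iff two_ne_zero |>.1
      ((Finset.sum_eq_zero_iff_of_nonneg fun _ _ => sq_nonneg _).1 h0 f hf)))
  refine (h1.map χ).ne_zero ?_
  simp [map_constSection]

/-- Every ring homomorphism from the ring of global sections to the real numbers is the evaluation
of the constant term at a point. -/
theorem exists_eq_bodyAt (χ : smoothSections p 𝒱 U ⊤ →+* ℝ) :
    ∃ x : (⊤ : Opens U), χ = bodyAt x := by
  classical
  -- The support of `g` is exactly `U`, so its level set at `χ G ≠ 0` is closed in the whole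
  -- Euclidean space; fixing the norm as well makes it compact.
  obtain ⟨g, hgs, hgd, -⟩ := U.isOpen.exists_contDiff_support_eq (n := ⊤)
  let G : smoothSections p 𝒱 U ⊤ := ofSmooth _ (contMDiff_comp_coe ⊤ hgd)
  let N : smoothSections p 𝒱 U ⊤ := ofSmooth _ (contMDiff_comp_coe ⊤ (contDiff_norm_sq ℝ))
  have hG : χ G ≠ 0 := by
    refine ((isUnit_of_body_ne_zero G fun x => ?_).map χ).ne_zero
    rw [body_ofSmooth]
    exact Function.mem_support.1 (hgs ▸ x.1.2)
  let K : Set (⊤ : Opens U) := {x | bodyAt x G = χ G ∧ bodyAt x N = χ N}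
  have hK : IsCompact K := by
    rw [(Topology.IsInducing.subtypeVal.comp Topology.IsInducing.subtypeVal).isCompact_iff]
    have h1 : (Subtype.val ∘ Subtype.val : (⊤ : Opens U) → _) '' K =
        {x | g x = χ G ∧ ‖x‖ ^ 2 = χ N} := by
      ext x
      constructor
      · rintro ⟨y, hy, rfl⟩
        simpa [K, G, N, bodyAt_apply] using hy
      · intro hx
        have hxU : x ∈ (U : Set _) := by
          rw [← hgs, Function.mem_support, hx.1]
          exact hG
        exact ⟨⟨⟨x, hxU⟩, trivial⟩, by simpa [K, G, N, bodyAt_apply] using hx, rfl⟩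
    refine (congrArg IsCompact h1).mpr ?_
    refine Metric.isCompact_of_isClosed_isBounded ?_ ?_
    · exact (isClosed_eq hgd.continuous continuous_const).inter
        (isClosed_eq (by fun_prop) continuous_const)
    · refine (Metric.isBounded_closedBall (x := 0) (r := √(χ N))).subset fun x hx => ?_
      rw [mem_closedBall_zero_iff]
      exact Real.le_sqrt_of_sq_le hx.2.le
  -- Finite intersection property: any finite set of sections, enlarged by `G` and `N`, has a common
  -- point in `K`.
  obtain ⟨x, -, hx⟩ := hK.inter_iInter_nonempty
    (fun f : smoothSections p 𝒱 U ⊤ => {x | bodyAt x f = χ f})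
    (fun f => isClosed_eq (contMDiff_body f).continuous continuous_const) (fun u => by
      obtain ⟨x, hx⟩ := exists_bodyAt_eq_of_finset χ (insert G (insert N u))
      refine ⟨x, ⟨hx G (by simp), hx N (by simp)⟩, Set.mem_iInter₂.2 fun f hf => hx f ?_⟩
      simp [hf])
  exact ⟨x, RingHom.ext fun f => (Set.mem_iInter.1 hx f).symm⟩

theorem eq_of_bodyAt_eq {x y : (⊤ : Opens U)}
    (h : ∀ f : smoothSections p 𝒱 U ⊤, bodyAt x f = bodyAt y f) : x = y := by
  refine Subtype.ext (Subtype.ext (PiLp.ext fun i => ?_))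
  have := h (ofSmooth _ (contMDiff_comp_coe ⊤ (h := fun x => x i) (by fun_prop)))
  simpa [bodyAt_apply] using this

end Points

/-! ### Local agreement and cutoff extensions -/

section Extension

variable {I : Type*} [NonUnitalCommSemiring I] {p : I →+ ZMod 2}
  {V : Type} [AddCommGroup V] [Module ℝ V] {𝒱 : I → Submodule ℝ V}
  {m : ℕ} {U : Opens (EuclideanSpace ℝ (Fin m))}

open Topology

/-- Two sections agree near a point. -/
def AgreeNear {W W' : Opens U} (f : W → formalSym p 𝒱) (g : W' → formalSym p 𝒱) (x : U) : Prop :=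
  ∀ᶠ y in 𝓝 x, ∀ (h : y ∈ W) (h' : y ∈ W'), f ⟨y, h⟩ = g ⟨y, h'⟩

/-- Agreement is vacuous outside the common domain, so the middle section must be defined near `x`.
-/
theorem AgreeNear.trans_of_mem {W₁ W₂ W₃ : Opens U} {f : W₁ → formalSym p 𝒱}
    {g : W₂ → formalSym p 𝒱} {h : W₃ → formalSym p 𝒱} {x : U} (hx : x ∈ W₂)
    (hfg : AgreeNear f g x) (hgh : AgreeNear g h x) : AgreeNear f h x := by
  filter_upwards [hfg, hgh, W₂.isOpen.mem_nhds hx] with y h1 h2 hy h3 h4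
  exact (h1 h3 hy).trans (h2 hy h4)

theorem AgreeNear.symm {W₁ W₂ : Opens U} {f : W₁ → formalSym p 𝒱} {g : W₂ → formalSym p 𝒱} {x : U}
    (h : AgreeNear f g x) : AgreeNear g f x := by
  filter_upwards [h] with y h h1 h2 using (h h2 h1).symm

variable [FiniteDimensional ℝ V]

theorem isSmooth_of_agreeNear {W : Opens U} {f : W → formalSym p 𝒱}
    (h : ∀ x : W, ∃ (W' : Opens U) (g : smoothSections p 𝒱 U W'), x.1 ∈ W' ∧ AgreeNear f g.1 x.1) :
    IsSmooth p 𝒱 U f := by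
  classical
  intro n l x
  obtain ⟨W', g, hx, hfg⟩ := h x
  -- Extension by the junk value 0 lets functions on different open sets be compared as functions on
  -- `U`.
  let ext (W : Opens U) (f : W → formalSym p 𝒱) (y : U) : ℝ :=
    if hy : y ∈ W then l (component n (f ⟨y, hy⟩)) else 0
  have hext (W : Opens U) (f : W → formalSym p 𝒱) :
      (fun y : W => ext W f y.1) = fun y => l (component n (f y)) :=
    funext fun y => dif_pos y.2
  rw [← hext, contMDiffAt_subtype_iff]
  have hg := g.2 n l ⟨x.1, hx⟩
  rw [← hext, contMDiffAt_subtype_iff] at hg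
  refine hg.congr_of_eventuallyEq ?_
  filter_upwards [hfg, W.isOpen.mem_nhds x.2, W'.isOpen.mem_nhds hx] with y hy h1 h2
  have h1 : y ∈ W := h1
  have h2 : y ∈ W' := h2
  simp only [ext, dif_pos h1, dif_pos h2, hy h1 h2]

/-- Every section can be extended by a cutoff function to a global section, without changing it near
a given point. -/
theorem exists_cutoff_extension {W : Opens U} (f : smoothSections p 𝒱 U W) {y : U} (hy : y ∈ W) :
    ∃ g : smoothSections p 𝒱 U ⊤, AgreeNear g.1 f.1 y ∧ (∀ x, x.1 ∉ W → g.1 x = 0) ∧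
      ∀ x (h : x.1 ∈ W), ∃ r : ℝ, g.1 x = scalar p 𝒱 r * f.1 ⟨x.1, h⟩ := by
  classical
  have hW : IsOpen (Subtype.val '' (W : Set U)) := U.isOpen.isOpenMap_subtype_val _ W.isOpen
  obtain ⟨r, hr, hball⟩ := Metric.nhds_basis_closedBall.mem_iff.1 (hW.mem_nhds ⟨y, hy, rfl⟩)
  let ρ : ContDiffBump y.1 := ⟨r / 2, r, by positivity, by linarith⟩
  have hsupp (x : U) (hx : x ∉ W) : x.1 ∉ Metric.closedBall y.1 r := fun h => by
    obtain ⟨z, hz, hzx⟩ := hball h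
    exact hx (Subtype.ext hzx ▸ hz)
  let G : (⊤ : Opens U) → formalSym p 𝒱 := fun x =>
    if h : x.1 ∈ W then scalar p 𝒱 (ρ x.1.1) * f.1 ⟨x.1, h⟩ else 0
  have hG : IsSmooth p 𝒱 U G := by
    refine isSmooth_of_agreeNear fun x => ?_
    by_cases hx : x.1 ∈ W
    · exact ⟨W, ofSmooth _ (contMDiff_comp_coe W ρ.contDiff) * f, hx,
        Filter.Eventually.of_forall fun z _ hz => dif_pos hz⟩
    -- Off `W` a whole neighbourhood misses the closed ball that contains the support of `ρ`.
    · refine ⟨⊤, 0, trivial, ?_⟩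
      have : ∀ᶠ z : U in 𝓝 x.1, z.1 ∉ Metric.closedBall y.1 r :=
        (Metric.isClosed_closedBall.isOpen_compl.preimage continuous_subtype_val).mem_nhds
          (hsupp _ hx)
      filter_upwards [this] with z hz _ _
      have h0 : ρ z.1 = 0 := by
        rw [← Function.notMem_support, ρ.support_eq]
        exact fun h => hz (Metric.ball_subset_closedBall h)
      simp only [G, h0, map_zero, zero_mul, dite_eq_ite, ite_self]
      rfl
  refine ⟨⟨G, hG⟩, ?_, fun x hx => dif_neg hx, fun x hx => ⟨_, dif_pos hx⟩⟩
  have h1 : ∀ᶠ z : U in 𝓝 y, ρ z.1 = 1 :=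
    continuous_subtype_val.continuousAt.eventually ρ.eventuallyEq_one
  filter_upwards [h1] with z hz _ hzW
  simp only [G, dif_pos hzW, hz, map_one, one_mul]

end Extension

/-! ### The base map and the localization of `φ` -/

section LocalMap

open Topology

/-- The value of the constant term of a global section at a point. -/
abbrev globalBodyAt {I : Type*} [NonUnitalCommSemiring I] {p : I →+ ZMod 2}
    {V : Type} [AddCommGroup V] [Module ℝ V] {𝒱 : I → Submodule ℝ V}
    {m : ℕ} {U : Opens (EuclideanSpace ℝ (Fin m))} [FiniteDimensional ℝ V] (x : U) :
    smoothSections p 𝒱 U ⊤ →+* ℝ :=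
  bodyAt (⟨x, trivial⟩ : (⊤ : Opens U))

variable {I : Type*} [NonUnitalCommSemiring I] {p : I →+ ZMod 2}
  {V₁ : Type} [AddCommGroup V₁] [Module ℝ V₁] {𝒱₁ : I → Submodule ℝ V₁}
  {V₂ : Type} [AddCommGroup V₂] [Module ℝ V₂] {𝒱₂ : I → Submodule ℝ V₂}
  {m₁ m₂ : ℕ} {U₁ : Opens (EuclideanSpace ℝ (Fin m₁))} {U₂ : Opens (EuclideanSpace ℝ (Fin m₂))}
  [FiniteDimensional ℝ V₁] [FiniteDimensional ℝ V₂]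
  (φ : smoothSections p 𝒱₂ U₂ ⊤ →+* smoothSections p 𝒱₁ U₁ ⊤)

/-- The map of points induced by a ring homomorphism between the rings of global sections. -/
def basePoint (x : U₁) : U₂ :=
  (exists_eq_bodyAt ((globalBodyAt x).comp φ)).choose.1

theorem bodyAt_map (x : U₁) (f : smoothSections p 𝒱₂ U₂ ⊤) :
    globalBodyAt x (φ f) = globalBodyAt (basePoint φ x) f :=
  congrArg (fun h : _ →+* ℝ => h f)
    (exists_eq_bodyAt ((globalBodyAt x).comp φ)).choose_spec

theorem eq_basePoint {x : U₁} {y : U₂}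
    (h : ∀ f, globalBodyAt x (φ f) = globalBodyAt y f) : y = basePoint φ x :=
  congrArg Subtype.val (eq_of_bodyAt_eq fun f => (h f).symm.trans (bodyAt_map φ x f))

/-- The coordinates of the base map are the bodies of the images of the coordinate functions. -/
theorem continuous_basePoint : Continuous (basePoint φ) := by
  rw [continuous_induced_rng, (PiLp.homeomorph 2 _).isInducing.continuous_iff]
  refine continuous_pi fun i => ?_
  have h := (contMDiff_body (φ (ofSmooth _
    (contMDiff_comp_coe ⊤ (h := fun x => x i) (by fun_prop))))).continuous
  have h' : Continuous fun x : U₁ => (⟨x, trivial⟩ : (⊤ : Opens U₁)) := by fun_prop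
  refine (h.comp h').congr fun x => ?_
  have := bodyAt_map φ x (ofSmooth _
    (contMDiff_comp_coe ⊤ (h := fun x => x i) (by fun_prop)))
  rwa [bodyAt_apply, bodyAt_apply, body_ofSmooth] at this

/-- A cutoff `χ` supported where `g` vanishes gives `φ χ * φ g = 0`, and `φ χ` has body 1 at `x`,
hence is invertible near `x`. -/
theorem map_agreeNear_zero {g : smoothSections p 𝒱₂ U₂ ⊤} {x : U₁}
    (h : AgreeNear g.1 (0 : smoothSections p 𝒱₂ U₂ ⊤).1 (basePoint φ x)) :
    AgreeNear (φ g).1 (0 : smoothSections p 𝒱₁ U₁ ⊤).1 x := by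
  obtain ⟨s, hs, hso, hxs⟩ := eventually_nhds_iff.1 h
  obtain ⟨χ, h1, h2, -⟩ := exists_cutoff_extension (W := ⟨s, hso⟩)
    (1 : smoothSections p 𝒱₂ U₂ _) hxs
  have h3 : χ * g = 0 := by
    refine Subtype.ext (funext fun y => ?_)
    change χ.1 y * g.1 y = 0
    by_cases hy : y.1 ∈ s
    · rw [hs y.1 hy trivial trivial]
      exact mul_zero _
    · rw [h2 y hy, zero_mul]
  have h4 : globalBodyAt x (φ χ) = 1 := by
    rw [bodyAt_map, bodyAt_apply, h1.self_of_nhds trivial hxs]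
    exact map_one (body p 𝒱₂)
  let W : Opens U₁ := ⟨{y | globalBodyAt y (φ χ) ≠ 0}, by
    have h' : Continuous fun x : U₁ => (⟨x, trivial⟩ : (⊤ : Opens U₁)) := by fun_prop
    exact isOpen_ne.preimage ((contMDiff_body (φ χ)).continuous.comp h')⟩
  have h5 := isUnit_of_body_ne_zero (smoothSections.restrict p 𝒱₁ (le_top : W ≤ ⊤) (φ χ))
    fun y => y.2
  have h6 : smoothSections.restrict p 𝒱₁ (le_top : W ≤ ⊤) (φ g) = 0 := by
    refine h5.mul_right_eq_zero.1 ?_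
    rw [← map_mul, ← map_mul, h3, map_zero, map_zero]
  have hxW : x ∈ W := by
    change globalBodyAt x (φ χ) ≠ 0
    rw [h4]
    exact one_ne_zero
  filter_upwards [W.isOpen.mem_nhds hxW] with y hy _ _
  exact congrFun (congrArg Subtype.val h6) ⟨y, hy⟩

theorem map_agreeNear {g g' : smoothSections p 𝒱₂ U₂ ⊤} {x : U₁}
    (h : AgreeNear g.1 g'.1 (basePoint φ x)) : AgreeNear (φ g).1 (φ g').1 x := by
  have h1 : AgreeNear (φ (g - g')).1 (0 : smoothSections p 𝒱₁ U₁ ⊤).1 x := by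
    refine map_agreeNear_zero φ ?_
    filter_upwards [h] with y hy h1 h2
    exact sub_eq_zero.2 (hy h1 h2)
  filter_upwards [h1] with y hy h1 h2
  have := hy h1 h2
  rw [map_sub] at this
  exact sub_eq_zero.1 this

/-- The value of the image of a section, computed with any global extension. -/
def localValue {W : Opens U₂} (f : smoothSections p 𝒱₂ U₂ W) (x : U₁) (hx : basePoint φ x ∈ W) :
    formalSym p 𝒱₁ :=
  (φ (exists_cutoff_extension f hx).choose).1 ⟨x, trivial⟩

/-- Independence of the chosen extension, from which all algebraic properties of `localValue`
follow. -/
theorem localValue_eq {W : Opens U₂} {f : smoothSections p 𝒱₂ U₂ W} {x : U₁}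
    (hx : basePoint φ x ∈ W) {g : smoothSections p 𝒱₂ U₂ ⊤}
    (hg : AgreeNear g.1 f.1 (basePoint φ x)) :
    localValue φ f x hx = (φ g).1 ⟨x, trivial⟩ :=
  (map_agreeNear φ ((exists_cutoff_extension f hx).choose_spec.1.trans_of_mem hx
    hg.symm)).self_of_nhds trivial trivial

theorem localValue_add {W : Opens U₂} (f f' : smoothSections p 𝒱₂ U₂ W) {x : U₁}
    (hx : basePoint φ x ∈ W) :
    localValue φ (f + f') x hx = localValue φ f x hx + localValue φ f' x hx := by
  obtain ⟨g, hg, -⟩ := exists_cutoff_extension f hx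
  obtain ⟨g', hg', -⟩ := exists_cutoff_extension f' hx
  rw [localValue_eq φ hx hg, localValue_eq φ hx hg', localValue_eq φ (g := g + g'), map_add]
  · rfl
  · filter_upwards [hg, hg'] with y hy hy' h1 h2
    exact congrArg₂ (· + ·) (hy h1 h2) (hy' h1 h2)

theorem localValue_mul {W : Opens U₂} (f f' : smoothSections p 𝒱₂ U₂ W) {x : U₁}
    (hx : basePoint φ x ∈ W) :
    localValue φ (f * f') x hx = localValue φ f x hx * localValue φ f' x hx := by
  obtain ⟨g, hg, -⟩ := exists_cutoff_extension f hx
  obtain ⟨g', hg', -⟩ := exists_cutoff_extension f' hx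
  rw [localValue_eq φ hx hg, localValue_eq φ hx hg', localValue_eq φ (g := g * g'), map_mul]
  · rfl
  · filter_upwards [hg, hg'] with y hy hy' h1 h2
    exact congrArg₂ (· * ·) (hy h1 h2) (hy' h1 h2)

theorem localValue_one {W : Opens U₂} {x : U₁} (hx : basePoint φ x ∈ W) :
    localValue φ (1 : smoothSections p 𝒱₂ U₂ W) x hx = 1 := by
  rw [localValue_eq φ (g := 1) hx (Filter.Eventually.of_forall fun _ _ _ => rfl), map_one]
  rfl

theorem localValue_zero {W : Opens U₂} {x : U₁} (hx : basePoint φ x ∈ W) :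
    localValue φ (0 : smoothSections p 𝒱₂ U₂ W) x hx = 0 := by
  rw [localValue_eq φ (g := 0) hx (Filter.Eventually.of_forall fun _ _ _ => rfl), map_zero]
  rfl

theorem isSmooth_localValue {W₁ : Opens U₁} {W₂ : Opens U₂} (h : ∀ x ∈ W₁, basePoint φ x ∈ W₂)
    (f : smoothSections p 𝒱₂ U₂ W₂) :
    IsSmooth p 𝒱₁ U₁ fun x : W₁ => localValue φ f x.1 (h x.1 x.2) :=
  isSmooth_of_agreeNear fun x => by
    obtain ⟨g, hg, -⟩ := exists_cutoff_extension f (h x.1 x.2)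
    refine ⟨⊤, φ g, trivial, ?_⟩
    -- Agreement near a point persists at nearby points, so by continuity the one extension `g`
    -- serves all points near `x`.
    filter_upwards [(continuous_basePoint φ).continuousAt.eventually
      (eventually_eventually_nhds.2 hg)] with y hy h1 _
    exact localValue_eq φ (h y h1) hy

theorem localValue_restrict {W W' : Opens U₂} (h : W' ≤ W) (f : smoothSections p 𝒱₂ U₂ W) {x : U₁}
    (hx : basePoint φ x ∈ W') :
    localValue φ (smoothSections.restrict p 𝒱₂ h f) x hx = localValue φ f x (h hx) := by
  obtain ⟨g, hg, -⟩ := exists_cutoff_extension f (h hx)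
  rw [localValue_eq φ (h hx) hg]
  refine localValue_eq φ hx ?_
  filter_upwards [hg] with y hy h1 h2 using hy h1 (h h2)

/-- The extension of a homomorphism between the rings of global sections to the rings of sections
over smaller open sets. -/
def localMap (W₁ : Opens U₁) (W₂ : Opens U₂) (h : ∀ x ∈ W₁, basePoint φ x ∈ W₂) :
    smoothSections p 𝒱₂ U₂ W₂ →+* smoothSections p 𝒱₁ U₁ W₁ where
  toFun f := ⟨fun x => localValue φ f x.1 (h x.1 x.2), isSmooth_localValue φ h f⟩
  map_one' := Subtype.ext (funext fun x => localValue_one φ (h x.1 x.2))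
  map_zero' := Subtype.ext (funext fun x => localValue_zero φ (h x.1 x.2))
  map_add' f f' := Subtype.ext (funext fun x => localValue_add φ f f' (h x.1 x.2))
  map_mul' f f' := Subtype.ext (funext fun x => localValue_mul φ f f' (h x.1 x.2))

theorem localMap_apply {W₁ : Opens U₁} {W₂ : Opens U₂} (h : ∀ x ∈ W₁, basePoint φ x ∈ W₂)
    (f : smoothSections p 𝒱₂ U₂ W₂) (x : W₁) :
    (localMap φ W₁ W₂ h f).1 x = localValue φ f x.1 (h x.1 x.2) := rfl

theorem bodyAt_localMap {W₁ : Opens U₁} {W₂ : Opens U₂} (h : ∀ x ∈ W₁, basePoint φ x ∈ W₂)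
    (f : smoothSections p 𝒱₂ U₂ W₂) (x : W₁) :
    bodyAt x (localMap φ W₁ W₂ h f) = bodyAt ⟨basePoint φ x.1, h x.1 x.2⟩ f := by
  obtain ⟨g, hg, -⟩ := exists_cutoff_extension f (h x.1 x.2)
  rw [bodyAt_apply, localMap_apply, localValue_eq φ _ hg]
  refine (bodyAt_map φ x.1 g).trans ?_
  rw [bodyAt_apply, hg.self_of_nhds trivial (h x.1 x.2), bodyAt_apply]

end LocalMap

/-! ### Invertible germs -/

section Stalks

variable {I : Type*} [NonUnitalCommSemiring I] {p : I →+ ZMod 2}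
  {V : Type} [AddCommGroup V] [Module ℝ V] {𝒱 : I → Submodule ℝ V}
  {m : ℕ} {U : Opens (EuclideanSpace ℝ (Fin m))} [FiniteDimensional ℝ V]

theorem germ_restrict {W W' : Opens U} (h : W' ≤ W) {x : U} (hx : x ∈ W')
    (f : smoothSections p 𝒱 U W) :
    (structurePresheaf p 𝒱 U).germ W' x hx (smoothSections.restrict p 𝒱 h f) =
      (structurePresheaf p 𝒱 U).germ W x (h hx) f :=
  (structurePresheaf p 𝒱 U).germ_res_apply (homOfLE h) x hx f

theorem bodyAt_eq_of_germ_eq {W W' : Opens U} {x : U} (hx : x ∈ W) (hx' : x ∈ W')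
    {f : smoothSections p 𝒱 U W} {g : smoothSections p 𝒱 U W'}
    (h : (structurePresheaf p 𝒱 U).germ W x hx f = (structurePresheaf p 𝒱 U).germ W' x hx' g) :
    bodyAt ⟨x, hx⟩ f = bodyAt ⟨x, hx'⟩ g := by
  obtain ⟨W₀, hx₀, i, j, h2⟩ := (structurePresheaf p 𝒱 U).germ_eq x _ _ _ _ h
  exact congrArg (bodyAt (⟨x, hx₀⟩ : W₀)) h2

/-- A germ is invertible if and only if its constant term does not vanish at the point. -/
theorem isUnit_germ_iff {W : Opens U} {x : U} (hx : x ∈ W) (f : smoothSections p 𝒱 U W) :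
    IsUnit ((structurePresheaf p 𝒱 U).germ W x hx f) ↔ bodyAt ⟨x, hx⟩ f ≠ 0 := by
  constructor
  · rintro hu h0
    obtain ⟨t, ht⟩ := hu.exists_right_inv
    obtain ⟨W', hx', g, rfl⟩ := (structurePresheaf p 𝒱 U).exists_germ_eq t
    let W'' : Opens U := W ⊓ W'
    have h1 : (structurePresheaf p 𝒱 U).germ W'' x ⟨hx, hx'⟩
        (smoothSections.restrict p 𝒱 (inf_le_left : W'' ≤ W) f *
          smoothSections.restrict p 𝒱 (inf_le_right : W'' ≤ W') g) =
        (structurePresheaf p 𝒱 U).germ W'' x ⟨hx, hx'⟩ (1 : smoothSections p 𝒱 U W'') := by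
      refine (map_mul ((structurePresheaf p 𝒱 U).germ W'' x ⟨hx, hx'⟩).hom _ _).trans ?_
      refine Eq.trans ?_ (map_one ((structurePresheaf p 𝒱 U).germ W'' x ⟨hx, hx'⟩).hom).symm
      exact (congrArg₂ (· * ·) (germ_restrict inf_le_left _ f)
        (germ_restrict inf_le_right _ g)).trans ht
    have h2 := bodyAt_eq_of_germ_eq _ _ h1
    rw [map_mul, map_one] at h2
    change bodyAt ⟨x, hx⟩ f * _ = 1 at h2
    rw [h0, zero_mul] at h2
    exact zero_ne_one h2
  · intro h
    have ho : IsOpen (Subtype.val '' {y : W | bodyAt y f ≠ 0}) :=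
      W.isOpen.isOpenMap_subtype_val _ (isOpen_ne.preimage (contMDiff_body f).continuous)
    have hle : (⟨_, ho⟩ : Opens U) ≤ W := by
      rintro _ ⟨y, -, rfl⟩
      exact y.2
    have hu : IsUnit (smoothSections.restrict p 𝒱 hle f) := by
      refine isUnit_of_body_ne_zero _ ?_
      rintro ⟨_, y, hy, rfl⟩
      exact hy
    have hx' : x ∈ (⟨_, ho⟩ : Opens U) := ⟨⟨x, hx⟩, h, rfl⟩
    rw [← germ_restrict hle hx']
    exact hu.map ((structurePresheaf p 𝒱 U).germ _ x hx').hom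

end Stalks

/-! ### Gradings, stalk maps and uniqueness -/

theorem IsHomogeneousSeries.scalar_mul {I : Type*} [NonUnitalCommSemiring I] {p : I →+ ZMod 2}
    {V : Type} [AddCommGroup V] [Module ℝ V] {𝒱 : I → Submodule ℝ V} {i : I} {f : formalSym p 𝒱}
    (hf : IsHomogeneousSeries i f) (r : ℝ) : IsHomogeneousSeries i (scalar p 𝒱 r * f) := fun n => by
  rw [component_scalar_mul]
  exact Submodule.smul_mem _ _ (hf n)

namespace GradedDomain

variable {I : Type*} [NonUnitalCommSemiring I] {p : I →+ ZMod 2} {𝒰₁ 𝒰₂ : GradedDomain I}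

/-- The cutoff extension is at each point zero or a real multiple of `f`, so it is again homogeneous
of degree `i`. -/
theorem localMap_preservesGrading {φ : 𝒰₂.Sections p ⊤ →+* 𝒰₁.Sections p ⊤}
    (hφ : PreservesGrading φ) (W₁ : Opens 𝒰₁.U) (W₂ : Opens 𝒰₂.U)
    (h : ∀ x ∈ W₁, basePoint φ x ∈ W₂) : PreservesGrading (localMap φ W₁ W₂ h) := by
  intro i f hf x
  obtain ⟨g, hg, h0, h1⟩ := exists_cutoff_extension f (h x.1 x.2)
  rw [localMap_apply, localValue_eq φ _ hg]
  refine hφ i g (fun y => ?_) _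
  by_cases hy : y.1 ∈ W₂
  · obtain ⟨r, hr⟩ := h1 y hy
    rw [hr]
    exact (hf _).scalar_mul r
  · rw [h0 y hy]
    intro n
    simp [component]

variable (p 𝒰₁ 𝒰₂) in
/-- The morphism of ringed spaces given by a homomorphism between the rings of global sections. -/
def ringedSpaceHom (φ : 𝒰₂.Sections p ⊤ →+* 𝒰₁.Sections p ⊤) :
    𝒰₁.toRingedSpace p ⟶ 𝒰₂.toRingedSpace p where
  hom :=
    { base := TopCat.ofHom ⟨basePoint φ, continuous_basePoint φ⟩
      c :=
        { app W := RingCat.ofHom (localMap φ _ W.unop fun _ hx => hx)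
          naturality W W' i := by
            refine RingCat.hom_ext (RingHom.ext fun f => Subtype.ext (funext fun x => ?_))
            exact localValue_restrict φ (leOfHom i.unop) f x.2 } }

theorem germ_stalkMap (ψ : 𝒰₁.toRingedSpace p ⟶ 𝒰₂.toRingedSpace p) (W : Opens 𝒰₂.U)
    (x : 𝒰₁.U) (hx : ψ.hom.base x ∈ W) (f : 𝒰₂.Sections p W) :
    (ψ.hom.stalkMap x).hom ((structurePresheaf p 𝒰₂.grade 𝒰₂.U).germ W (ψ.hom.base x) hx f) =
      (structurePresheaf p 𝒰₁.grade 𝒰₁.U).germ ((Opens.map ψ.hom.base).obj W) x hx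
        (pullback ψ W f) :=
  AlgebraicGeometry.PresheafedSpace.stalkMap_germ_apply ψ.hom W x hx f

theorem pullback_restrict (ψ : 𝒰₁.toRingedSpace p ⟶ 𝒰₂.toRingedSpace p) {W W' : Opens 𝒰₂.U}
    (h : W' ≤ W) (f : 𝒰₂.Sections p W) (x : 𝒰₁.U) (hx : ψ.hom.base x ∈ W') :
    (pullback ψ W' (smoothSections.restrict p 𝒰₂.grade h f)).1 ⟨x, hx⟩ =
      (pullback ψ W f).1 ⟨x, h hx⟩ := by
  have h1 := ConcreteCategory.congr_hom (ψ.hom.c.naturality (homOfLE h).op) f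
  exact congrFun (congrArg Subtype.val h1) ⟨x, hx⟩

theorem pullback_eq_of_agreeNear (ψ : 𝒰₁.toRingedSpace p ⟶ 𝒰₂.toRingedSpace p)
    {W W' : Opens 𝒰₂.U} {f : 𝒰₂.Sections p W} {f' : 𝒰₂.Sections p W'} {x : 𝒰₁.U}
    (hx : ψ.hom.base x ∈ W) (hx' : ψ.hom.base x ∈ W') (h : AgreeNear f.1 f'.1 (ψ.hom.base x)) :
    (pullback ψ W f).1 ⟨x, hx⟩ = (pullback ψ W' f').1 ⟨x, hx'⟩ := by
  obtain ⟨s, hs, hso, hxs⟩ := eventually_nhds_iff.1 h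
  let W₀ : Opens 𝒰₂.U := ⟨s, hso⟩ ⊓ (W ⊓ W')
  have h1 : W₀ ≤ W := inf_le_right.trans inf_le_left
  have h2 : W₀ ≤ W' := inf_le_right.trans inf_le_right
  have h3 : smoothSections.restrict p 𝒰₂.grade h1 f = smoothSections.restrict p 𝒰₂.grade h2 f' :=
    Subtype.ext (funext fun y => hs y.1 y.2.1 y.2.2.1 y.2.2.2)
  refine (pullback_restrict ψ h1 f x ⟨hxs, hx, hx'⟩).symm.trans ?_
  rw [h3]
  exact pullback_restrict ψ h2 f' x ⟨hxs, hx, hx'⟩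

theorem isUnit_stalkMap_germ_iff (ψ : 𝒰₁.toRingedSpace p ⟶ 𝒰₂.toRingedSpace p) (W : Opens 𝒰₂.U)
    (x : 𝒰₁.U) (hx : ψ.hom.base x ∈ W) (f : 𝒰₂.Sections p W) :
    IsUnit ((ψ.hom.stalkMap x).hom
        ((structurePresheaf p 𝒰₂.grade 𝒰₂.U).germ W (ψ.hom.base x) hx f)) ↔
      bodyAt (⟨x, hx⟩ : (Opens.map ψ.hom.base).obj W) (pullback ψ W f) ≠ 0 :=
  (iff_of_eq (congrArg IsUnit (germ_stalkMap ψ W x hx f))).trans (isUnit_germ_iff (U := 𝒰₁.U) hx _)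

theorem isLocalHom_stalkMap_of_bodyAt (ψ : 𝒰₁.toRingedSpace p ⟶ 𝒰₂.toRingedSpace p) (x : 𝒰₁.U)
    (h : ∀ (W : Opens 𝒰₂.U) (hx : ψ.hom.base x ∈ W) (f : 𝒰₂.Sections p W),
      bodyAt (⟨x, hx⟩ : (Opens.map ψ.hom.base).obj W) (pullback ψ W f) =
        bodyAt (⟨ψ.hom.base x, hx⟩ : W) f) :
    IsLocalHom (ψ.hom.stalkMap x).hom := by
  constructor
  intro t ht
  obtain ⟨W, hx, f, rfl⟩ := (structurePresheaf p 𝒰₂.grade 𝒰₂.U).exists_germ_eq t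
  refine (isUnit_germ_iff hx f).2 ?_
  rw [← h W hx f]
  exact (isUnit_stalkMap_germ_iff ψ W x hx f).1 ht

/-- If `r` is the body of `f` at the image point, the germ of `f - r` there is not invertible; by
locality neither is that of its pullback, whose body therefore vanishes at `x`. -/
theorem Hom.bodyAt_pullback (ψ : Hom p 𝒰₁ 𝒰₂) (W : Opens 𝒰₂.U) (x : 𝒰₁.U)
    (hx : ψ.toRingedSpaceHom.hom.base x ∈ W) (f : 𝒰₂.Sections p W) :
    bodyAt (⟨x, hx⟩ : (Opens.map ψ.toRingedSpaceHom.hom.base).obj W)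
        (pullback ψ.toRingedSpaceHom W f) =
      bodyAt (⟨ψ.toRingedSpaceHom.hom.base x, hx⟩ : W) f := by
  let r : ℝ := bodyAt (⟨ψ.toRingedSpaceHom.hom.base x, hx⟩ : W) f
  let χ : 𝒰₂.Sections p W →+* ℝ :=
    (bodyAt (⟨x, hx⟩ : (Opens.map ψ.toRingedSpaceHom.hom.base).obj W)).comp
      (pullback ψ.toRingedSpaceHom W)
  have h0 : χ (f - constSection W r) = 0 := by
    by_contra hne
    have h1 := (isUnit_stalkMap_germ_iff ψ.toRingedSpaceHom W x hx (f - constSection W r)).2 hne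
    have h2 := (isUnit_germ_iff hx _).1 ((ψ.isLocalHom_stalkMap x).map_nonunit _ h1)
    refine h2 ?_
    rw [map_sub, bodyAt_constSection]
    exact sub_self r
  rw [map_sub, map_constSection, sub_eq_zero] at h0
  exact h0

theorem Hom.base_eq_basePoint (ψ : Hom p 𝒰₁ 𝒰₂) (x : 𝒰₁.U) :
    ψ.toRingedSpaceHom.hom.base x = basePoint ψ.globalPullback x :=
  eq_basePoint _ fun f => ψ.bodyAt_pullback ⊤ x trivial f

theorem Hom.eq_of_globalPullback_eq {ψ ψ' : Hom p 𝒰₁ 𝒰₂}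
    (h : ψ.globalPullback = ψ'.globalPullback) : ψ = ψ' := by
  have hbase : ψ.toRingedSpaceHom.hom.base = ψ'.toRingedSpaceHom.hom.base :=
    TopCat.hom_ext (ContinuousMap.ext fun x => by
      refine (ψ.base_eq_basePoint x).trans ?_
      rw [h]
      exact (ψ'.base_eq_basePoint x).symm)
  obtain ⟨⟨⟨base, c⟩⟩, hψ, hψp⟩ := ψ
  obtain ⟨⟨⟨base', c'⟩⟩, hψ', hψp'⟩ := ψ'
  dsimp at hbase
  subst hbase
  have hc : c = c' := by
    refine NatTrans.ext (funext fun W => RingCat.hom_ext (RingHom.ext fun f => ?_))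
    refine Subtype.ext (funext fun x => ?_)
    -- Both pullbacks of `f` at `x` equal those of a global extension, where they agree by
    -- hypothesis.
    obtain ⟨g, hg, -⟩ := exists_cutoff_extension (W := W.unop) f x.2
    have h1 := pullback_eq_of_agreeNear ⟨⟨base, c⟩⟩ (W := ⊤) (x := x.1) (Set.mem_univ _) x.2 hg
    have h2 := pullback_eq_of_agreeNear ⟨⟨base, c'⟩⟩ (W := ⊤) (x := x.1) (Set.mem_univ _) x.2 hg
    refine h1.symm.trans (Eq.trans ?_ h2)
    exact congrFun (congrArg Subtype.val (congrArg (fun k : _ →+* _ => k g) h)) _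
  subst hc
  rfl

end GradedDomain

end GradedGeometry

end

/-! ### Existence and uniqueness of the morphism -/

open GradedGeometry in
theorem mainTheorem3 {I : Type*} [NonUnitalCommSemiring I] [IsCancelAdd I] [Countable I]
    (p : I →+ ZMod 2) (hp : p ≠ 0) (𝒰₁ 𝒰₂ : GradedDomain I)
    (φ : 𝒰₂.Sections p ⊤ →+* 𝒰₁.Sections p ⊤) (hφ : GradedDomain.PreservesGrading φ) :
    ∃! ψ : GradedDomain.Hom p 𝒰₁ 𝒰₂, ψ.globalPullback = φ := by
  have h : ∀ ψ : GradedDomain.Hom p 𝒰₁ 𝒰₂, ψ.toRingedSpaceHom =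
      GradedDomain.ringedSpaceHom p 𝒰₁ 𝒰₂ φ → ψ.globalPullback = φ := by
    intro ψ hψ
    refine RingHom.ext fun f => Subtype.ext (funext fun x => ?_)
    rw [GradedDomain.Hom.globalPullback, hψ]
    -- A global section is its own global extension.
    exact localValue_eq φ (W := ⊤) (f := f) (x := x.1) (g := f) (Set.mem_univ _)
      (Filter.Eventually.of_forall fun _ _ _ => rfl)
  let ψ : GradedDomain.Hom p 𝒰₁ 𝒰₂ :=
    { toRingedSpaceHom := GradedDomain.ringedSpaceHom p 𝒰₁ 𝒰₂ φ
      isLocalHom_stalkMap := fun x =>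
        GradedDomain.isLocalHom_stalkMap_of_bodyAt _ x fun W hx f =>
          bodyAt_localMap φ (W₁ := (Opens.map
            (GradedDomain.ringedSpaceHom p 𝒰₁ 𝒰₂ φ).hom.base).obj W) (fun _ h => h) f ⟨x, hx⟩
      preservesGrading := fun W => GradedDomain.localMap_preservesGrading hφ _ W fun _ hx => hx }
  exact ⟨ψ, h ψ rfl, fun ψ' hψ' => GradedDomain.Hom.eq_of_globalPullback_eq (hψ'.trans (h ψ rfl).symm)⟩
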